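/- Let $\omega>0$, $\kappa>0$ and $\gamma>0$ be constants. Consider the coherently controlled qubit system for the Bloch vector $\mathbf r=(r_x,r_y,r_z)\in\mathbb R^3$, $$\dot{\mathbf r}=\omega f_0(\mathbf r)+2\kappa\, u(t) f_1(\mathbf r),\qquad f_0(\mathbf r)=\begin{pmatrix}-r_y\\ r_x\\ 0\end{pmatrix}-\frac{\gamma}{\omega}\begin{pmatrix}\frac12 r_x\\ \frac12 r_y\\ r_z\end{pmatrix}+\frac{\gamma}{\omega}\begin{pmatrix}0\\0\\1\end{pmatrix},\qquad f_1(\mathbf r)=\begin{pmatrix}0\\-r_z\\ r_y\end{pmatrix}.$$ For $\mathbf r^0\in\mathbb R^3$ let $C_+(\mathbf r^0)$ be the set of all points $\mathbf r(T)$, where $T\ge 0$ and $\mathbf r:[0,T]\to\mathbb R^3$ is an absolutely continuous function that satisfies $\mathbf r(0)=\mathbf r^0$ and solves the system almost everywhere on $[0,T]$ for some control $u\in L^1([0,T];\mathbb R)$. Then for every $\mathbf r^0\in\mathbb R^3$ (in particular, for every $\mathbf r^0$ in the Bloch ball $|\mathbf r^0|\le 1$) $$\operatorname{int}(\operatorname{cl}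 C_+(\mathbf r^0))\subset C_+(\mathbf r^0)\subset \operatorname{cl} C_+(\mathbf r^0)=\operatorname{cl}(\operatorname{int} C_+(\mathbf r^0)),$$ where interiors and closures are taken in $\mathbb R^3$ and $\subset$ denotes not necessarily strict inclusion. -/

import Mathlib

open MeasureTheory Set

/-- The space `ℝ³` of Bloch vectors `r = (r_x, r_y, r_z) = (r 0, r 1, r 2)`. -/
abbrev BlochSpace : Type := EuclideanSpace ℝ (Fin 3)

/-- The drift field
`f₀(r) = (-r_y, r_x, 0) - (γ/ω) (r_x/2, r_y/2, r_z) + (γ/ω) (0, 0, 1)`. -/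
noncomputable def driftField (ω γ : ℝ) (r : BlochSpace) : BlochSpace :=
  !₂[-r 1, r 0, 0] - (γ / ω) • !₂[r 0 / 2, r 1 / 2, r 2] + (γ / ω) • !₂[0, 0, 1]

/-- The field of the coherent control, `f₁(r) = (0, -r_z, r_y)`. -/
noncomputable def controlField (r : BlochSpace) : BlochSpace :=
  !₂[0, -r 2, r 1]

/-- `r` is a trajectory on `[0, T]` of the coherently controlled system
`ṙ = ω f₀(r) + 2 κ f₁(r) u` for the control `u ∈ L¹(0, T)`: it is absolutely continuous on `[0, T]`
and satisfies the equation at almost every `t ∈ [0, T]`. -/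
structure IsCoherentTrajectory (ω κ γ T : ℝ) (u : ℝ → ℝ) (r : ℝ → BlochSpace) : Prop where
  integrable_control : IntervalIntegrable u volume 0 T
  absolutelyContinuous : AbsolutelyContinuousOnInterval r 0 T
  ae_hasDerivAt : ∀ᵐ t ∂(volume.restrict (Icc 0 T)),
    HasDerivAt r (ω • driftField ω γ (r t) + (2 * κ * u t) • controlField (r t)) t

/-- The forward reachable set `C₊(r⁰)` of the coherently controlled system: all end points `r(T)`,
`T ≥ 0`, of its trajectories with `r(0) = r⁰`. -/
def coherentReachableSet (ω κ γ : ℝ) (r₀ : BlochSpace) : Set BlochSpace :=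
  {r₁ | ∃ (T : ℝ) (u : ℝ → ℝ) (r : ℝ → BlochSpace),
    0 ≤ T ∧ IsCoherentTrajectory ω κ γ T u r ∧ r 0 = r₀ ∧ r T = r₁}

/-!
Under a constant control the system is an affine field, with a complete and invertible flow. Hence
the set `C` of points reachable from `r⁰` is forward invariant under the flows of `X = ω f₀` and
`Y = ω f₀ + f₁`, and the set of points from which a given `p` is reachable is forward invariant
under the flows of such fields with all parameters negated. Any set `C` of this kind lies in the
closure of its interior:

* where `X`, `Y` and `[X, Y]` are linearly independent, following `X`, `Y`, `X` for small positive
  times gives submersions into `C`;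
* where they are dependent, a polynomial `h` vanishes. If it vanished on a nonempty relatively open
  part of `C`, so would all its derivatives along `f₁ = Y - X`, hence all its Fourier components
  under the rotations generated by `f₁`. The invariant one is `-ω (r_y² + r_z²)`, so `r_z` and its
  derivative `γ (1 - r_z)` along `X` would both vanish.

Finally, if `p` is interior to the closure of `C`, then some open set of points from which `p` is
reachable meets the closure of `C`, hence meets `C`, and `p ∈ C`.
-/

open Filter MvPolynomial Topology VectorField

section Concatenation

theorem absolutelyContinuousOnInterval_comp_of_monotoneOn {X : Type*} [PseudoMetricSpace X]
    {f : ℝ → X} {φ : ℝ → ℝ} {a b c d : ℝ} (hf : AbsolutelyContinuousOnInterval f a b)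
    (hφ : AbsolutelyContinuousOnInterval φ c d) (hmono : MonotoneOn φ (uIcc c d))
    (hmaps : MapsTo φ (uIcc c d) (uIcc a b)) : AbsolutelyContinuousOnInterval (f ∘ φ) c d := by
  rw [absolutelyContinuousOnInterval_iff] at hf hφ ⊢
  intro ε hε
  obtain ⟨η, hη, hfη⟩ := hf ε hε
  obtain ⟨δ, hδ, hφδ⟩ := hφ η hη
  refine ⟨δ, hδ, fun E hE hlen ↦
    hfη (E.1, fun i ↦ (φ (E.2 i).1, φ (E.2 i).2)) ⟨fun i hi ↦ ?_, ?_⟩ (hφδ E hE hlen)⟩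
  · exact ⟨hmaps (hE.1 i hi).1, hmaps (hE.1 i hi).2⟩
  · intro i hi j hj hij
    have hdisj := hE.2 hi hj hij
    obtain ⟨hi₁, hi₂⟩ := hE.1 i hi
    obtain ⟨hj₁, hj₂⟩ := hE.1 j hj
    simp only [Function.onFun, uIoc, Ioc_disjoint_Ioc] at hdisj ⊢
    grind [MonotoneOn]

variable {F : Type*}

/-- The concatenation at time `T` of two paths `r₁` on `[0, T]` and `r₂` on `[0, S]`. For
`r₁ T = r₂ 0` the formula equals `r₁ t` before `T` and `r₂ (t - T)` after `T`; written without case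
distinction it inherits the absolute continuity of `r₁` and `r₂`. -/
def concatPath [AddGroup F] (T : ℝ) (r₁ r₂ : ℝ → F) (t : ℝ) : F :=
  r₁ (min t T) + (r₂ (max (t - T) 0) - r₂ 0)

theorem concatPath_of_le [AddGroup F] {T t : ℝ} (r₁ r₂ : ℝ → F) (ht : t ≤ T) :
    concatPath T r₁ r₂ t = r₁ t := by
  simp [concatPath, ht]

theorem concatPath_of_ge [AddCommGroup F] {T t : ℝ} {r₁ r₂ : ℝ → F} (h : r₁ T = r₂ 0)
    (ht : T ≤ t) : concatPath T r₁ r₂ t = r₂ (t - T) := by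
  simp [concatPath, ht, h]

theorem absolutelyContinuousOnInterval_concatPath [SeminormedAddCommGroup F] {T S : ℝ}
    {r₁ r₂ : ℝ → F} (hT : 0 ≤ T) (hS : 0 ≤ S) (h₁ : AbsolutelyContinuousOnInterval r₁ 0 T)
    (h₂ : AbsolutelyContinuousOnInterval r₂ 0 S) :
    AbsolutelyContinuousOnInterval (concatPath T r₁ r₂) 0 (T + S) := by
  have hmin : LipschitzWith 1 fun t : ℝ ↦ min t T := LipschitzWith.id.min_const T
  have hmax : LipschitzWith 1 fun t : ℝ ↦ max (t - T) 0 :=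
    (LipschitzWith.of_dist_le_mul fun s t ↦ by simp).max_const 0
  refine (absolutelyContinuousOnInterval_comp_of_monotoneOn h₁
    hmin.lipschitzOnWith.absolutelyContinuousOnInterval ?_ ?_).fun_add
    ((absolutelyContinuousOnInterval_comp_of_monotoneOn h₂
      hmax.lipschitzOnWith.absolutelyContinuousOnInterval ?_ ?_).fun_sub
    (LipschitzWith.const (r₂ 0)).lipschitzOnWith.absolutelyContinuousOnInterval)
  · exact fun s _ t _ hst ↦ min_le_min_right T hst
  · rw [uIcc_of_le (by linarith), uIcc_of_le hT]
    exact fun t ht ↦ ⟨le_min ht.1 hT, min_le_right t T⟩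
  · exact fun s _ t _ hst ↦ max_le_max_right 0 (sub_le_sub_right hst T)
  · rw [uIcc_of_le (by linarith), uIcc_of_le hS]
    exact fun t ht ↦ ⟨le_max_right _ _, max_le (by linarith [ht.2]) hS⟩

theorem intervalIntegrable_piecewise_Iic [NormedAddCommGroup F] {T S : ℝ} {u₁ u₂ : ℝ → F}
    (hT : 0 ≤ T) (hS : 0 ≤ S) (h₁ : IntervalIntegrable u₁ volume 0 T)
    (h₂ : IntervalIntegrable u₂ volume 0 S) :
    IntervalIntegrable ((Iic T).piecewise u₁ fun t ↦ u₂ (t - T)) volume 0 (T + S) := by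
  have h₂' : IntervalIntegrable (fun t ↦ u₂ (t - T)) volume T (T + S) := by
    simpa [add_comm] using h₂.comp_sub_right T
  refine (h₁.congr fun t ht ↦ ?_).trans (h₂'.congr fun t ht ↦ ?_)
  · rw [uIoc_of_le hT] at ht
    exact (piecewise_eq_of_mem (Iic T) u₁ _ ht.2).symm
  · rw [uIoc_of_le (by linarith)] at ht
    exact (piecewise_eq_of_notMem (Iic T) u₁ (fun t ↦ u₂ (t - T)) (notMem_Iic.2 ht.1)).symm

theorem ae_restrict_Icc_add {T S : ℝ} {p q : ℝ → Prop}
    (hp : ∀ᵐ t ∂volume.restrict (Icc 0 T), p t) (hq : ∀ᵐ t ∂volume.restrict (Icc 0 S), q t) :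
    ∀ᵐ t ∂volume.restrict (Icc 0 (T + S)), t < T ∧ p t ∨ T < t ∧ q (t - T) := by
  rw [ae_restrict_iff' measurableSet_Icc] at hp hq ⊢
  have hq' := (measurePreserving_sub_right volume T).quasiMeasurePreserving.ae hq
  filter_upwards [hp, hq', Measure.ae_ne volume T] with t hpt hqt hne ht
  rcases lt_or_gt_of_ne hne with hlt | hlt
  · exact .inl ⟨hlt, hpt ⟨ht.1, hlt.le⟩⟩
  · exact .inr ⟨hlt, hqt ⟨by linarith, by linarith [ht.2]⟩⟩

end Concatenation

section AffineFlow

variable {E : Type*} [NormedAddCommGroup E] [NormedSpace ℝ E]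

/-- The linear field on `E × ℝ` that restricts to the affine field `X` on the hyperplane
`E × {1}`; its exponential integrates `X`. -/
noncomputable def homogenization (X : E →ᴬ[ℝ] E) : (E × ℝ) →L[ℝ] (E × ℝ) :=
  (X.contLinear.coprod (ContinuousLinearMap.toSpanSingleton ℝ (X 0))).prod 0

theorem homogenization_snd (X : E →ᴬ[ℝ] E) (z : E × ℝ) : (homogenization X z).2 = 0 := rfl

theorem homogenization_apply_one (X : E →ᴬ[ℝ] E) (p : E) :
    homogenization X (p, 1) = (X p, 0) := by
  simpa [homogenization] using! (X.map_vadd 0 p).symm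

theorem homogenization_neg (X : E →ᴬ[ℝ] E) : homogenization (-X) = -homogenization X := by
  ext <;> simp [homogenization]

variable (X Y : E →ᴬ[ℝ] E)

/-- The linear part of the time-`t` map of the flow of `X`, which is an affine map. -/
noncomputable def affineFlowLinear (t : ℝ) : E →L[ℝ] E :=
  ContinuousLinearMap.fst ℝ E ℝ ∘L NormedSpace.exp (t • homogenization X) ∘L
    ContinuousLinearMap.inl ℝ E ℝ

@[simp]
theorem affineFlowLinear_zero : affineFlowLinear X 0 = .id ℝ E := by
  ext v
  simp [affineFlowLinear]

variable [CompleteSpace E]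

theorem exp_smul_homogenization_snd (t : ℝ) (z : E × ℝ) :
    (NormedSpace.exp (t • homogenization X) z).2 = z.2 := by
  have hderiv (s : ℝ) :
      HasDerivAt (fun s : ℝ ↦ (NormedSpace.exp (s • homogenization X) z).2) 0 s := by
    simpa [homogenization_snd] using! (ContinuousLinearMap.snd ℝ E ℝ).hasFDerivAt.comp_hasDerivAt s
      ((hasDerivAt_exp_smul_const' (homogenization X) s).clm_apply (hasDerivAt_const s z))
  simpa using is_const_of_deriv_eq_zero (fun s ↦ (hderiv s).differentiableAt)
    (fun s ↦ (hderiv s).deriv) t 0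

/-- The flow of the affine vector field `X`. -/
noncomputable def affineFlow : Flow ℝ E where
  toFun t p := (NormedSpace.exp (t • homogenization X) (p, 1)).1
  cont' := by
    let _ : NormedAlgebra ℚ ((E × ℝ) →L[ℝ] (E × ℝ)) := NormedAlgebra.restrictScalars ℚ ℝ _
    exact (((NormedSpace.exp_continuous.comp (continuous_fst.smul continuous_const)).clm_apply
      (continuous_snd.prodMk continuous_const))).fst
  map_add' s t p := by
    have hcomm : Commute (s • homogenization X) (t • homogenization X) :=
      ((Commute.refl _).smul_left s).smul_right t
    have hp : NormedSpace.exp (t • homogenization X) (p, 1) =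
        ((NormedSpace.exp (t • homogenization X) (p, 1)).1, 1) :=
      Prod.ext rfl (exp_smul_homogenization_snd X t (p, 1))
    let _ : NormedAlgebra ℚ ((E × ℝ) →L[ℝ] (E × ℝ)) := NormedAlgebra.restrictScalars ℚ ℝ _
    rw [add_smul, NormedSpace.exp_add_of_commute hcomm, ← hp]
    rfl
  map_zero' p := by simp

theorem exp_smul_homogenization_apply_one (t : ℝ) (p : E) :
    NormedSpace.exp (t • homogenization X) (p, 1) = (affineFlow X t p, 1) :=
  Prod.ext rfl (exp_smul_homogenization_snd X t (p, 1))

theorem affineFlow_neg : affineFlow (-X) = (affineFlow X).reverse :=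
  Flow.ext fun t p ↦ by
    simp only [Flow.reverse_apply, affineFlow, homogenization_neg, smul_neg, ← neg_smul]

theorem affineFlowLinear_apply (t : ℝ) (v : E) :
    affineFlowLinear X t v = affineFlow X t v - affineFlow X t 0 := by
  simp [affineFlowLinear, affineFlow, ← Prod.fst_sub, ← map_sub]

theorem hasStrictFDerivAt_affineFlow (t : ℝ) (p : E) :
    HasStrictFDerivAt (fun z : ℝ × E ↦ affineFlow X z.1 z.2)
      ((ContinuousLinearMap.toSpanSingleton ℝ (X (affineFlow X t p))).coprod
        (affineFlowLinear X t)) (t, p) := by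
  have hexp := (hasStrictDerivAt_exp_smul_const' (homogenization X) t).hasStrictFDerivAt.comp
    (t, p) (hasStrictFDerivAt_fst (𝕜 := ℝ) (E := ℝ) (F := E))
  have hlift := (hasStrictFDerivAt_snd (𝕜 := ℝ) (p := (t, p))).prodMk
    (hasStrictFDerivAt_const (1 : ℝ) (t, p))
  refine (hexp.clm_apply hlift).fst.congr_fderiv ?_
  ext <;> simp [exp_smul_homogenization_apply_one, homogenization_apply_one, affineFlowLinear,
    Prod.mk_zero_zero]

attribute [irreducible] affineFlow

@[fun_prop]
theorem continuous_affineFlowLinear_apply {α : Type*} [TopologicalSpace α] {τ : α → ℝ} {v : α → E}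
    (hτ : Continuous τ) (hv : Continuous v) :
    Continuous fun a ↦ affineFlowLinear X (τ a) (v a) := by
  simp only [affineFlowLinear_apply]
  fun_prop

theorem hasDerivAt_affineFlow (t : ℝ) (p : E) :
    HasDerivAt (fun t ↦ affineFlow X t p) (X (affineFlow X t p)) t := by
  simpa using! (hasStrictFDerivAt_affineFlow X t p).hasFDerivAt.comp_hasDerivAt t
    ((hasDerivAt_id t).prodMk (hasDerivAt_const t p))

theorem hasDerivAt_affineFlowLinear (t : ℝ) (v : E) :
    HasDerivAt (fun t ↦ affineFlowLinear X t v) (X.contLinear (affineFlowLinear X t v)) t := by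
  simp only [affineFlowLinear_apply]
  refine ((hasDerivAt_affineFlow X t v).sub (hasDerivAt_affineFlow X t 0)).congr_deriv ?_
  exact (X.contLinear_map_vsub _ _).symm

theorem absolutelyContinuousOnInterval_affineFlow (p : E) (a b : ℝ) :
    AbsolutelyContinuousOnInterval (fun t ↦ affineFlow X t p) a b := by
  refine (ContDiff.contDiffOn (contDiff_one_iff_deriv.2
    ⟨fun t ↦ (hasDerivAt_affineFlow X t p).differentiableAt, ?_⟩)).absolutelyContinuousOnInterval
  rw [funext fun t ↦ (hasDerivAt_affineFlow X t p).deriv]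
  fun_prop

/-- The end point of the path that leaves `q` along `X` for time `s 2`, continues along `Y` for
time `s 1` and ends along `X` for time `s 0`. -/
noncomputable def switchMap (q : E) (s : Fin 3 → ℝ) : E :=
  affineFlow X (s 0) (affineFlow Y (s 1) (affineFlow X (s 2) q))

/-- The partial derivatives of `switchMap X Y q` at `s`. -/
noncomputable def switchFrame (q : E) (s : Fin 3 → ℝ) : Fin 3 → E :=
  ![X (switchMap X Y q s),
    affineFlowLinear X (s 0) (Y (affineFlow Y (s 1) (affineFlow X (s 2) q))),
    affineFlowLinear X (s 0) (affineFlowLinear Y (s 1) (X (affineFlow X (s 2) q)))]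

@[fun_prop]
theorem continuous_switchMap (q : E) : Continuous (switchMap X Y q) := by
  unfold switchMap
  fun_prop

theorem continuous_switchFrame (q : E) : Continuous (switchFrame X Y q) := by
  unfold switchFrame
  fun_prop

theorem hasStrictFDerivAt_switchMap (q : E) (s : Fin 3 → ℝ) :
    HasStrictFDerivAt (switchMap X Y q)
      (Fintype.linearCombination ℝ (switchFrame X Y q s)).toContinuousLinearMap s := by
  have htime (i : Fin 3) := (ContinuousLinearMap.proj (R := ℝ) (φ := fun _ : Fin 3 ↦ ℝ) i
    ).hasStrictFDerivAt (x := s)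
  have h₂ := (hasStrictFDerivAt_affineFlow X (s 2) q).comp s
    ((htime 2).prodMk (hasStrictFDerivAt_const q s))
  have h₁ := (hasStrictFDerivAt_affineFlow Y (s 1) _).comp s ((htime 1).prodMk h₂)
  have h₀ := (hasStrictFDerivAt_affineFlow X (s 0) _).comp s ((htime 0).prodMk h₁)
  refine h₀.congr_fderiv ?_
  ext σ
  simp [Fintype.linearCombination_apply, Fin.sum_univ_three, switchFrame, switchMap, add_assoc]

variable {X Y}

theorem switchMap_mem_interior {C : Set E} (hX : IsForwardInvariant (affineFlow X) C)
    (hY : IsForwardInvariant (affineFlow Y) C) (hE : Module.finrank ℝ E = 3) {q : E} (hq : q ∈ C)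
    {s : Fin 3 → ℝ} (hs : ∀ i, 0 < s i) (hli : LinearIndependent ℝ (switchFrame X Y q s)) :
    switchMap X Y q s ∈ interior C := by
  have hsurj : (Fintype.linearCombination ℝ
      (switchFrame X Y q s)).toContinuousLinearMap.range = ⊤ :=
    (Fintype.range_linearCombination ℝ _).trans
      (hli.span_eq_top_of_card_eq_finrank (by simp [hE]))
  rw [mem_interior_iff_mem_nhds,
    ← (hasStrictFDerivAt_switchMap X Y q s).map_nhds_eq_of_surj hsurj, mem_map]
  have hpos : ∀ᶠ x in 𝓝 s, ∀ i, 0 < x i :=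
    eventually_all.2 fun i ↦ (continuous_apply i).continuousAt.eventually_const_lt (hs i)
  filter_upwards [hpos] with x hx
  exact hX (hx 0).le (hY (hx 1).le (hX (hx 2).le hq))

theorem linearIndependent_add_smul_of_linearIndependent {K V : Type*} [Field K] [AddCommGroup V]
    [Module K V] {a b c : V} {t : K} (ht : t ≠ 0) (h : LinearIndependent K ![a, b, c]) :
    LinearIndependent K ![a, b, a + t • c] := by
  rw [Fintype.linearIndependent_iff] at h ⊢
  intro g hg
  have := h ![g 0 + g 2, g 1, g 2 * t] (by
    simp only [Fin.sum_univ_three, Matrix.cons_val] at hg ⊢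
    rw [← hg]
    module)
  simp [Fin.forall_fin_succ] at this ⊢
  grind

/-- After time `t` along `Y` the first and the last vector of the frame differ by
`t • [X, Y] q + o(t)`. -/
theorem eventually_linearIndependent_switchFrame {q : E}
    (hli : LinearIndependent ℝ ![X q, Y q, lieBracket ℝ X Y q]) :
    ∀ᶠ t in 𝓝[≠] (0 : ℝ), LinearIndependent ℝ (switchFrame X Y q ![0, t, 0]) := by
  let d : ℝ → E := fun t ↦ affineFlowLinear Y t (X q) - X (affineFlow Y t q)
  have hd : HasDerivAt d (lieBracket ℝ X Y q) 0 := by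
    have hX := X.hasFDerivAt.comp_hasDerivAt 0 (hasDerivAt_affineFlow Y 0 q)
    simpa [lieBracket, d] using! (hasDerivAt_affineFlowLinear Y 0 (X q)).sub hX
  have hflow : Tendsto (fun t ↦ affineFlow Y t q) (𝓝[≠] 0) (𝓝 q) := by
    simpa using! (hasDerivAt_affineFlow Y 0 q).continuousAt.tendsto.mono_left nhdsWithin_le_nhds
  have hlim : Tendsto (fun t ↦ ![X (affineFlow Y t q), Y (affineFlow Y t q), slope d 0 t])
      (𝓝[≠] 0) (𝓝 ![X q, Y q, lieBracket ℝ X Y q]) :=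
    ((X.continuous.tendsto q).comp hflow).matrixVecCons
      (((Y.continuous.tendsto q).comp hflow).matrixVecCons
        (hd.tendsto_slope.matrixVecCons tendsto_const_nhds))
  filter_upwards [hlim.eventually hli.eventually, self_mem_nhdsWithin] with t hlit ht
  have hframe : switchFrame X Y q ![0, t, 0] =
      ![X (affineFlow Y t q), Y (affineFlow Y t q), X (affineFlow Y t q) + t • slope d 0 t] := by
    simp [switchFrame, switchMap, slope_def_module, smul_smul, mul_inv_cancel₀ ht, d]
  rw [hframe]
  exact linearIndependent_add_smul_of_linearIndependent ht hlit

theorem mem_closure_interior_of_linearIndependent_lieBracket {C : Set E}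
    (hX : IsForwardInvariant (affineFlow X) C) (hY : IsForwardInvariant (affineFlow Y) C)
    (hE : Module.finrank ℝ E = 3) {q : E} (hq : q ∈ C)
    (hli : LinearIndependent ℝ ![X q, Y q, lieBracket ℝ X Y q]) : q ∈ closure (interior C) := by
  have hcurve : ∀ᶠ t in 𝓝[>] (0 : ℝ), switchMap X Y q ![0, t, 0] ∈ closure (interior C) := by
    filter_upwards [(eventually_linearIndependent_switchFrame hli).filter_mono
      (nhdsWithin_mono 0 fun _ ↦ ne_of_gt), self_mem_nhdsWithin] with t hlit ht
    have htime : Tendsto (fun ε : ℝ ↦ ![ε, t, ε]) (𝓝[>] 0) (𝓝 ![0, t, 0]) :=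
      Continuous.tendsto' (by fun_prop) _ _ rfl |>.mono_left nhdsWithin_le_nhds
    refine mem_closure_of_tendsto (((continuous_switchMap X Y q).tendsto _).comp htime) ?_
    filter_upwards [(((continuous_switchFrame X Y q).tendsto _).comp htime).eventually
      hlit.eventually, self_mem_nhdsWithin] with ε hliε hε
    exact switchMap_mem_interior hX hY hE hq (by simp_all [Fin.forall_fin_succ]) hliε
  have hlim : Tendsto (fun t : ℝ ↦ switchMap X Y q ![0, t, 0]) (𝓝[>] 0) (𝓝 q) :=
    Continuous.tendsto' (by fun_prop) _ _ (by simp [switchMap]) |>.mono_left nhdsWithin_le_nhds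
  exact isClosed_closure.mem_of_tendsto hlim hcurve

end AffineFlow

section PolynomialFields

theorem mem_of_sum_mem_of_mem_eigenspace {ι K V : Type*} [Fintype ι] [Field K] [AddCommGroup V]
    [Module K V] {f : Module.End K V} {N : Submodule K V} (hN : N ≤ N.comap f) {μ : ι → K}
    (hμ : Function.Injective μ) {a : ι → V} (ha : ∀ i, a i ∈ f.eigenspace (μ i))
    (hsum : ∑ i, a i ∈ N) (i : ι) : a i ∈ N := by
  let g : Module.End K (V ⧸ N) := N.mapQ N f hN
  have heigen (j : ι) : N.mkQ (a j) ∈ g.eigenspace (μ j) := by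
    rw [Module.End.mem_eigenspace_iff, ← map_smul, ← Module.End.mem_eigenspace_iff.1 (ha j),
      Submodule.mkQ_apply, Submodule.mapQ_apply, Submodule.mkQ_apply]
  have hzero : ∑ j, N.mkQ (a j) = 0 := by
    rwa [← map_sum, Submodule.mkQ_apply, Submodule.Quotient.mk_eq_zero]
  have hindep := g.eigenspaces_iSupIndep.comp hμ
  rw [iSupIndep_iff_finsetSum_eq_zero_imp_eq_zero] at hindep
  simpa using hindep Finset.univ (fun j ↦ N.mkQ (a j)) (fun j _ ↦ heigen j) hzero i
    (Finset.mem_univ i)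

theorem hasDerivAt_eval_of_derivation {σ 𝕜 : Type*} [NontriviallyNormedField 𝕜]
    {D : Derivation 𝕜 (MvPolynomial σ 𝕜) (MvPolynomial σ 𝕜)} {c : 𝕜 → σ → 𝕜} {t : 𝕜}
    (hc : ∀ i, HasDerivAt (fun t ↦ c t i) (eval (c t) (D (X i))) t) (p : MvPolynomial σ 𝕜) :
    HasDerivAt (fun t ↦ eval (c t) p) (eval (c t) (D p)) t := by
  induction p using MvPolynomial.induction_on with
  | C a => simpa using hasDerivAt_const t a
  | add p q hp hq => simpa using hp.fun_add hq
  | mul_X p i hp =>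
    have hleibniz : eval (c t) (D p) * c t i + eval (c t) p * eval (c t) (D (X i)) =
        eval (c t) (D (p * X i)) := by
      simp only [Derivation.leibniz, smul_eq_mul, map_add, map_mul, eval_X]
      ring
    simpa only [map_mul, eval_X] using (hp.fun_mul (hc i)).congr_deriv hleibniz

theorem eq_zero_of_isForwardInvariant_of_hasDerivAt {α F : Type*} [TopologicalSpace α]
    [NormedAddCommGroup F] [NormedSpace ℝ F] {ϕ : Flow ℝ α} {C U : Set α}
    (hC : IsForwardInvariant ϕ C) (hU : IsOpen U) {h : α → F} (hz : ∀ p ∈ C ∩ U, h p = 0) {q : α}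
    (hq : q ∈ C ∩ U) {h' : F} (hd : HasDerivAt (fun t ↦ h (ϕ t q)) h' 0) : h' = 0 := by
  have hmem : ∀ᶠ t in 𝓝[≥] (0 : ℝ), ϕ t q ∈ U :=
    (ϕ.continuous continuous_id continuous_const).continuousWithinAt.eventually_mem
      (by simpa using hU.mem_nhds hq.2)
  refine UniqueDiffWithinAt.eq_deriv _ (uniqueDiffWithinAt_Ici 0) hd.hasDerivWithinAt ?_
  refine (hasDerivWithinAt_const (0 : ℝ) (Ici 0) (0 : F)).congr_of_eventuallyEq ?_
    (by simpa using hz q hq)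
  filter_upwards [hmem, self_mem_nhdsWithin] with t htU ht
  exact hz _ ⟨hC ht hq.1, htU⟩

theorem derivation_mem_vanishingIdeal {σ : Type*} [Fintype σ]
    {V : EuclideanSpace ℝ σ →ᴬ[ℝ] EuclideanSpace ℝ σ}
    {D : Derivation ℝ (MvPolynomial σ ℝ) (MvPolynomial σ ℝ)}
    (hD : ∀ q i, V q i = eval q (D (X i))) {C U : Set (EuclideanSpace ℝ σ)}
    (hC : IsForwardInvariant (affineFlow V) C) (hU : IsOpen U) {p : MvPolynomial σ ℝ}
    (hp : p ∈ vanishingIdeal ℝ (WithLp.ofLp '' (C ∩ U))) :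
    D p ∈ vanishingIdeal ℝ (WithLp.ofLp '' (C ∩ U)) := by
  rintro _ ⟨q, hq, rfl⟩
  have hflow (i : σ) : HasDerivAt (fun t ↦ affineFlow V t q i)
      (eval (affineFlow V 0 q) (D (X i))) 0 := by
    simpa [hD] using! (EuclideanSpace.proj (𝕜 := ℝ) i).hasFDerivAt.comp_hasDerivAt 0
      (hasDerivAt_affineFlow V 0 q)
  refine eq_zero_of_isForwardInvariant_of_hasDerivAt hC hU
    (h := fun x ↦ eval x p) (fun x hx ↦ hp _ ⟨x, hx, rfl⟩) hq ?_
  simpa [Flow.map_zero_apply] using! hasDerivAt_eval_of_derivation hflow p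

end PolynomialFields

section BlochFields

/-- The Bloch vector field `ω f₀ + v f₁` for a constant control amplitude `v = 2κu`, as an affine
map. -/
noncomputable def blochField (ω γ v : ℝ) : BlochSpace →ᴬ[ℝ] BlochSpace :=
  (Matrix.toEuclideanCLM (𝕜 := ℝ)
    !![-γ / 2, -ω, 0; ω, -γ / 2, -v; 0, v, -γ]).toContinuousAffineMap +
    ContinuousAffineMap.const ℝ _ !₂[0, 0, γ]

theorem blochField_apply (ω γ v : ℝ) (r : BlochSpace) :
    blochField ω γ v r = !₂[-γ / 2 * r 0 - ω * r 1, ω * r 0 - γ / 2 * r 1 - v * r 2,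
      v * r 1 + γ * (1 - r 2)] := by
  ext i
  fin_cases i <;>
    simp [blochField, Matrix.ofLp_toEuclideanCLM, Matrix.mulVec, dotProduct,
      Fin.sum_univ_three] <;> ring

theorem contLinear_blochField_apply (ω γ v : ℝ) (r : BlochSpace) :
    (blochField ω γ v).contLinear r = !₂[-γ / 2 * r 0 - ω * r 1,
      ω * r 0 - γ / 2 * r 1 - v * r 2, v * r 1 - γ * r 2] := by
  ext i
  fin_cases i <;>
    simp [blochField, Matrix.ofLp_toEuclideanCLM, Matrix.mulVec, dotProduct,
      Fin.sum_univ_three] <;> ring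

theorem neg_blochField (ω γ v : ℝ) : -blochField ω γ v = blochField (-ω) (-γ) (-v) := by
  ext r i
  fin_cases i <;> simp [blochField_apply] <;> ring

theorem smul_driftField_add_smul_controlField {ω : ℝ} (hω : ω ≠ 0) (γ v : ℝ) (r : BlochSpace) :
    ω • driftField ω γ r + v • controlField r = blochField ω γ v r := by
  ext i
  fin_cases i <;> simp [driftField, controlField, blochField_apply] <;> field_simp <;> ring

/-- The derivation of the polynomial functions on `BlochSpace` along `ω f₀`. -/
noncomputable def driftDerivation (ω γ : ℝ) :
    Derivation ℝ (MvPolynomial (Fin 3) ℝ) (MvPolynomial (Fin 3) ℝ) :=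
  mkDerivation ℝ ![C (-γ / 2) * X 0 - C ω * X 1, C ω * X 0 - C (γ / 2) * X 1, C γ * (1 - X 2)]

/-- The derivation of the polynomial functions on `BlochSpace` along `f₁`, the generator of the
rotations about the first axis. -/
noncomputable def rotationDerivation :
    Derivation ℝ (MvPolynomial (Fin 3) ℝ) (MvPolynomial (Fin 3) ℝ) :=
  mkDerivation ℝ ![0, -X 2, X 1]

theorem blochField_apply_eq_eval (ω γ v : ℝ) (q : BlochSpace) (i : Fin 3) :
    blochField ω γ v q i = eval q ((driftDerivation ω γ + v • rotationDerivation) (X i)) := by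
  fin_cases i <;> simp [blochField_apply, driftDerivation, rotationDerivation, mkDerivation_X] <;>
    ring

/-- The component of frequency `k` of `bracketPolynomial` under the rotations generated by
`rotationDerivation`. -/
noncomputable def bracketComponent (ω γ : ℝ) : Fin 4 → MvPolynomial (Fin 3) ℝ :=
  ![-C ω * (X 1 ^ 2 + X 2 ^ 2),
    C ω * (C (9 / 8) * X 2 * (X 1 ^ 2 + X 2 ^ 2) + C (1 / 2) * X 0 ^ 2 * X 2) -
      C (γ / 2) * X 0 * X 1,
    C (γ / 2) * X 0 * X 1 * X 2,
    C (ω / 8) * (3 * X 1 ^ 2 * X 2 - X 2 ^ 3)]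

/-- The determinant of `ω f₀`, `f₁` and their Lie bracket, divided by `γ`. -/
noncomputable def bracketPolynomial (ω γ : ℝ) : MvPolynomial (Fin 3) ℝ :=
  ∑ k, bracketComponent ω γ k

theorem bracketComponent_mem_eigenspace (ω γ : ℝ) (k : Fin 4) :
    bracketComponent ω γ k ∈ Module.End.eigenspace
      ((rotationDerivation : MvPolynomial (Fin 3) ℝ →ₗ[ℝ] MvPolynomial (Fin 3) ℝ) ^ 2)
      (-(k : ℝ) ^ 2) := by
  have h₀ : rotationDerivation (X 0) = 0 := mkDerivation_X ..
  have h₁ : rotationDerivation (X 1) = -X 2 := mkDerivation_X ..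
  have h₂ : rotationDerivation (X 2) = X 1 := mkDerivation_X ..
  have hthree : rotationDerivation 3 = 0 := rotationDerivation.map_natCast 3
  rw [Module.End.mem_eigenspace_iff]
  fin_cases k <;>
    simp [bracketComponent, pow_succ, h₀, h₁, h₂, hthree, Derivation.leibniz, smul_eq_C_mul,
      -mul_eq_zero, map_ofNat C] <;> ring

theorem linearIndependent_lieBracket_blochField {ω γ : ℝ} (hγ : γ ≠ 0) {q : BlochSpace}
    (hq : eval q (bracketPolynomial ω γ) ≠ 0) :
    LinearIndependent ℝ ![blochField ω γ 0 q, blochField ω γ 1 q,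
      lieBracket ℝ (blochField ω γ 0) (blochField ω γ 1) q] := by
  have hdet : (EuclideanSpace.basisFun (Fin 3) ℝ).toBasis.det ![blochField ω γ 0 q,
      blochField ω γ 1 q, lieBracket ℝ (blochField ω γ 0) (blochField ω γ 1) q] =
      γ * eval q (bracketPolynomial ω γ) := by
    rw [Module.Basis.det_apply, Matrix.det_fin_three]
    simp [lieBracket, ContinuousAffineMap.fderiv, contLinear_blochField_apply, blochField_apply,
      bracketPolynomial, bracketComponent, Fin.sum_univ_four, Module.Basis.toMatrix_apply]
    ring
  refine (((EuclideanSpace.basisFun (Fin 3) ℝ).toBasis.is_basis_iff_det).2 ?_).1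
  rw [hdet]
  exact (mul_ne_zero hγ hq).isUnit

theorem bracketComponent_zero_mem {ω γ : ℝ} {I : Ideal (MvPolynomial (Fin 3) ℝ)}
    (hI : ∀ p ∈ I, rotationDerivation p ∈ I) (h : bracketPolynomial ω γ ∈ I) :
    bracketComponent ω γ 0 ∈ I := by
  have hsq : Function.Injective fun k : Fin 4 ↦ -(k : ℝ) ^ 2 := by
    intro k l hkl
    simpa [Fin.ext_iff] using hkl
  refine mem_of_sum_mem_of_mem_eigenspace (N := I.restrictScalars ℝ) ?_ hsq
    (bracketComponent_mem_eigenspace ω γ) h 0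
  exact fun p hp ↦ hI _ (hI p hp)

theorem exists_eval_bracketPolynomial_ne_zero {ω γ : ℝ} (hω : ω ≠ 0) (hγ : γ ≠ 0)
    {C U : Set BlochSpace} (h₀ : IsForwardInvariant (affineFlow (blochField ω γ 0)) C)
    (h₁ : IsForwardInvariant (affineFlow (blochField ω γ 1)) C) (hU : IsOpen U)
    (hne : (C ∩ U).Nonempty) : ∃ q ∈ C ∩ U, eval q (bracketPolynomial ω γ) ≠ 0 := by
  by_contra! hzero
  let I : Ideal (MvPolynomial (Fin 3) ℝ) := vanishingIdeal ℝ (WithLp.ofLp '' (C ∩ U))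
  have hdrift : ∀ p ∈ I, driftDerivation ω γ p ∈ I := fun p hp ↦ by
    simpa only [zero_smul, add_zero] using
      derivation_mem_vanishingIdeal (blochField_apply_eq_eval ω γ 0) h₀ hU hp
  have hrotation : ∀ p ∈ I, rotationDerivation p ∈ I := fun p hp ↦ by
    simpa using! I.sub_mem
      (derivation_mem_vanishingIdeal (blochField_apply_eq_eval ω γ 1) h₁ hU hp) (hdrift p hp)
  have hcomponent : bracketComponent ω γ 0 ∈ I := by
    refine bracketComponent_zero_mem hrotation ?_
    rintro _ ⟨q, hq, rfl⟩
    exact hzero q hq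
  have hz : X 2 ∈ I := by
    rintro _ ⟨q, hq, rfl⟩
    have hyz : q 1 ^ 2 + q 2 ^ 2 = 0 := by
      simpa [bracketComponent, hω] using hcomponent _ ⟨q, hq, rfl⟩
    have : q 2 = 0 := by nlinarith [sq_nonneg (q 1), sq_nonneg (q 2)]
    simpa
  obtain ⟨q, hq⟩ := hne
  have hqz : q 2 = 0 := by simpa using hz _ ⟨q, hq, rfl⟩
  have hpump : γ * (1 - q 2) = 0 := by
    simpa [driftDerivation] using hdrift _ hz _ ⟨q, hq, rfl⟩
  simp [hqz, hγ] at hpump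

theorem subset_closure_interior_of_isForwardInvariant {ω γ : ℝ} (hω : ω ≠ 0) (hγ : γ ≠ 0)
    {C : Set BlochSpace} (h₀ : IsForwardInvariant (affineFlow (blochField ω γ 0)) C)
    (h₁ : IsForwardInvariant (affineFlow (blochField ω γ 1)) C) : C ⊆ closure (interior C) := by
  refine fun p hp ↦ mem_closure_iff.2 fun U hU hpU ↦ ?_
  obtain ⟨q, ⟨hqC, hqU⟩, hq⟩ := exists_eval_bracketPolynomial_ne_zero hω hγ h₀ h₁ hU ⟨p, hp, hpU⟩
  have hmem : q ∈ closure (interior C) := mem_closure_interior_of_linearIndependent_lieBracket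
    h₀ h₁ (by simp) hqC (linearIndependent_lieBracket_blochField hγ hq)
  exact mem_closure_iff.1 hmem U hU hqU

end BlochFields

section ReachableSet

theorem mem_of_mem_interior_closure_of_trans {α : Type*} [TopologicalSpace α] {R : α → Set α}
    (htrans : ∀ ⦃p q s⦄, q ∈ R p → s ∈ R q → s ∈ R p) {r p : α}
    (hp : p ∈ interior (closure (R r))) (hback : p ∈ closure (interior {q | p ∈ R q})) :
    p ∈ R r := by
  obtain ⟨s, hs, hsback⟩ := mem_closure_iff.1 hback _ isOpen_interior hp
  obtain ⟨q, hqback, hq⟩ :=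
    mem_closure_iff.1 (interior_subset hs) _ isOpen_interior hsback
  exact htrans hq (interior_subset hqback : q ∈ {q | p ∈ R q})

variable {ω κ γ : ℝ}

theorem IsCoherentTrajectory.concat {T S : ℝ} {u₁ u₂ : ℝ → ℝ} {r₁ r₂ : ℝ → BlochSpace}
    (hT : 0 ≤ T) (hS : 0 ≤ S) (h₁ : IsCoherentTrajectory ω κ γ T u₁ r₁)
    (h₂ : IsCoherentTrajectory ω κ γ S u₂ r₂) (h : r₁ T = r₂ 0) :
    IsCoherentTrajectory ω κ γ (T + S) ((Iic T).piecewise u₁ fun t ↦ u₂ (t - T))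
      (concatPath T r₁ r₂) where
  integrable_control :=
    intervalIntegrable_piecewise_Iic hT hS h₁.integrable_control h₂.integrable_control
  absolutelyContinuous :=
    absolutelyContinuousOnInterval_concatPath hT hS h₁.absolutelyContinuous h₂.absolutelyContinuous
  ae_hasDerivAt := by
    filter_upwards [ae_restrict_Icc_add h₁.ae_hasDerivAt h₂.ae_hasDerivAt] with t ht
    rcases ht with ⟨hlt, hd⟩ | ⟨hlt, hd⟩
    · rw [concatPath_of_le _ _ hlt.le, piecewise_eq_of_mem _ _ _ (mem_Iic.2 hlt.le)]
      refine hd.congr_of_eventuallyEq ?_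
      filter_upwards [eventually_lt_nhds hlt] with s hs
      exact concatPath_of_le _ _ hs.le
    · rw [concatPath_of_ge h hlt.le, piecewise_eq_of_notMem _ _ _ (notMem_Iic.2 hlt)]
      refine (hd.comp_sub_const t T).congr_of_eventuallyEq ?_
      filter_upwards [eventually_gt_nhds hlt] with s hs
      exact concatPath_of_ge h hs.le

theorem coherentReachableSet_trans {p q s : BlochSpace} (hq : q ∈ coherentReachableSet ω κ γ p)
    (hs : s ∈ coherentReachableSet ω κ γ q) : s ∈ coherentReachableSet ω κ γ p := by
  obtain ⟨T, u₁, r₁, hT, h₁, rfl, rfl⟩ := hq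
  obtain ⟨S, u₂, r₂, hS, h₂, hjoin, rfl⟩ := hs
  refine ⟨T + S, _, _, by positivity, h₁.concat hT hS h₂ hjoin.symm, concatPath_of_le _ _ hT, ?_⟩
  rw [concatPath_of_ge hjoin.symm (by linarith), add_sub_cancel_left]

theorem affineFlow_blochField_mem_coherentReachableSet (hω : ω ≠ 0) (hκ : κ ≠ 0) (v : ℝ) {t : ℝ}
    (ht : 0 ≤ t) (p : BlochSpace) :
    affineFlow (blochField ω γ v) t p ∈ coherentReachableSet ω κ γ p := by
  refine ⟨t, fun _ ↦ v / (2 * κ), fun s ↦ affineFlow (blochField ω γ v) s p, ht,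
    ⟨intervalIntegrable_const, absolutelyContinuousOnInterval_affineFlow _ p 0 t,
      .of_forall fun s ↦ ?_⟩, Flow.map_zero_apply _ p, rfl⟩
  rw [smul_driftField_add_smul_controlField hω, mul_div_cancel₀ v (mul_ne_zero two_ne_zero hκ)]
  exact hasDerivAt_affineFlow _ s p

theorem isForwardInvariant_coherentReachableSet (hω : ω ≠ 0) (hκ : κ ≠ 0) (v : ℝ)
    (r₀ : BlochSpace) :
    IsForwardInvariant (affineFlow (blochField ω γ v)) (coherentReachableSet ω κ γ r₀) :=
  fun _ ht p hp ↦
    coherentReachableSet_trans hp (affineFlow_blochField_mem_coherentReachableSet hω hκ v ht p)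

theorem isForwardInvariant_setOf_mem_coherentReachableSet (hω : ω ≠ 0) (hκ : κ ≠ 0) (v : ℝ)
    (p : BlochSpace) : IsForwardInvariant (affineFlow (blochField (-ω) (-γ) v))
      {q | p ∈ coherentReachableSet ω κ γ q} := by
  intro t ht q hq
  have hflow := affineFlow_blochField_mem_coherentReachableSet (γ := γ) hω hκ (-v) ht
    (affineFlow (blochField (-ω) (-γ) v) t q)
  have hback :
      affineFlow (blochField ω γ (-v)) t (affineFlow (blochField (-ω) (-γ) v) t q) = q := by
    rw [← neg_neg v, ← neg_blochField, affineFlow_neg, neg_neg, Flow.reverse_apply, ← Flow.map_add,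
      add_neg_cancel, Flow.map_zero_apply]
  rw [hback] at hflow
  exact coherentReachableSet_trans hflow hq

theorem coherentReachableSet_subset_closure_interior (hω : ω ≠ 0) (hκ : κ ≠ 0) (hγ : γ ≠ 0)
    (r₀ : BlochSpace) :
    coherentReachableSet ω κ γ r₀ ⊆ closure (interior (coherentReachableSet ω κ γ r₀)) :=
  subset_closure_interior_of_isForwardInvariant hω hγ
    (isForwardInvariant_coherentReachableSet hω hκ 0 r₀)
    (isForwardInvariant_coherentReachableSet hω hκ 1 r₀)

theorem mem_closure_interior_setOf_mem_coherentReachableSet (hω : ω ≠ 0) (hκ : κ ≠ 0) (hγ : γ ≠ 0)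
    (p : BlochSpace) : p ∈ closure (interior {q | p ∈ coherentReachableSet ω κ γ q}) := by
  have hself : p ∈ coherentReachableSet ω κ γ p := by
    simpa using affineFlow_blochField_mem_coherentReachableSet (γ := γ) hω hκ 0 le_rfl p
  exact subset_closure_interior_of_isForwardInvariant (neg_ne_zero.2 hω) (neg_ne_zero.2 hγ)
    (isForwardInvariant_setOf_mem_coherentReachableSet hω hκ 0 p)
    (isForwardInvariant_setOf_mem_coherentReachableSet hω hκ 1 p) hself

end ReachableSet

theorem theorem2_general {ω κ γ : ℝ} (hω : ω ≠ 0) (hκ : κ ≠ 0) (hγ : γ ≠ 0) (r₀ : BlochSpace) :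
    interior (closure (coherentReachableSet ω κ γ r₀)) ⊆ coherentReachableSet ω κ γ r₀ ∧
    coherentReachableSet ω κ γ r₀ ⊆ closure (coherentReachableSet ω κ γ r₀) ∧
    closure (coherentReachableSet ω κ γ r₀) =
      closure (interior (coherentReachableSet ω κ γ r₀)) := by
  refine ⟨fun p hp ↦ ?_, subset_closure, ?_⟩
  · exact mem_of_mem_interior_closure_of_trans (fun _ _ _ ↦ coherentReachableSet_trans) hp
      (mem_closure_interior_setOf_mem_coherentReachableSet hω hκ hγ p)
  · exact (closure_minimal (coherentReachableSet_subset_closure_interior hω hκ hγ r₀)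
      isClosed_closure).antisymm (closure_mono interior_subset)

theorem theorem2 (ω κ γ : ℝ) (hω : 0 < ω) (hκ : 0 < κ) (hγ : 0 < γ) (r₀ : BlochSpace) :
    interior (closure (coherentReachableSet ω κ γ r₀)) ⊆ coherentReachableSet ω κ γ r₀ ∧
    coherentReachableSet ω κ γ r₀ ⊆ closure (coherentReachableSet ω κ γ r₀) ∧
    closure (coherentReachableSet ω κ γ r₀) =
      closure (interior (coherentReachableSet ω κ γ r₀)) :=
  theorem2_general hω.ne' hκ.ne' hγ.ne' r₀
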